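/- Let $p$ be an odd prime, $q$ a power of $p$, and $n$ a natural number. Let $N=2n+1$ in type $B_n$ and $N=2n$ in types $C_n$, $D_n$, and write $\bar i=N+1-i$ for $1\le i\le N$. Let $G$ be the isometry group of the standard split form on $\mathbb F_q^N$ (so $G=O_{2n+1}(q)$, $Sp_{2n}(q)$, $O^+_{2n}(q)$ respectively), whose Gram matrix is supported on the anti-diagonal $\{(i,\bar i)\}$, with all entries there equal to $1$ in types $B_n, D_n$, and equal to $1$ in the rows $i\le n$ and $-1$ in the rows $i>n$ in type $C_n$. Let $U$ be the Sylow $p$-subgroup of $G$ consisting of the upper unitriangular matrices in $G$. Let $\triangle=\{(i,j): i<j<\bar i\}$, and let $\Phi=\triangle$ in types $B_n,D_n$ and $\Phi=\triangle\cup\{(i,\bar i): i<\bar i\}$ in type $C_n$. Let $V$ be the space of $N\times N$ matrices over $\mathbb F_q$ supported on $\Phi$, let $\pi$ be the projection of $N\times N$ matrices onto $V$ that replaces the entries outside $\Phi$ by $0$, and let $\kappa(A,B)=\sum_{i,j}A_{ij}B_{ij}$. Fix a non-trivial linear character $\theta:(\mathbb F_q,+)\to\mathbb C^*$. For $A\in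 V$ let $[A]$ be the linear character $B\mapsto\theta(-\kappa(A,B))$ of $(V,+)$; these are all the linear characters of $V$, and their set is denoted $\hat V$. The vector space $\mathbb C\hat V$ with basis $\hat V$ is a right $\mathbb CU$-module via $$[A]\,u=\theta\bigl(-\kappa(A,\pi(u^{-1}))\bigr)\,[A].u,\qquad [A].u=[\pi(A(u^{-1})^{t})]\qquad(A\in V,\ u\in U).$$ Let $\mathcal O_A=\{[A].u: u\in U\}$, and let the orbit module $\mathbb C\mathcal O_A\subseteq\mathbb C\hat V$ be the submodule spanned by $\mathcal O_A$. A main condition of $A\in V$ is a position $(i,j)\in\Phi$ such that $A_{ij}$ is the rightmost non-zero entry of row $i$ of $A$. The limb of $A$ consists of all positions $(\bar j,a)\in\triangle$ and all positions $(a,j)\in\triangle$ with $a>i$, where $(i,j)$ runs through the main conditions of $A$, and, in type $C_n$ only, also of the positions $(\bar j,j)$ for the main conditions $(i,j)\in\triangle$ of $A$ with $j>n$. The character $[A]$ is called main separated if no main condition of $A$ lies in the limb of $A$. **Theorem.** In each of the types $B_n$, $C_n$, $D_n$, every irreducible right $\mathbb CU$-module is a constituent of (equivalently, by complete reducibility,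 isomorphic to a submodule of) some orbit module $\mathbb C\mathcal O_A$ with $[A]\in\hat V$ main separated. -/

import Mathlib

open scoped Matrix

noncomputable section

namespace SylowClassical

/-- The Dynkin types `B_n`, `C_n`, `D_n`. -/
inductive DynkinType : Type
  | B
  | C
  | D

/-- The size `N` of the matrices: `2n+1` in type `B_n`, and `2n` in types `C_n` and `D_n`. -/
def matSize : DynkinType → ℕ → ℕ
  | .B, n => 2 * n + 1
  | .C, n => 2 * n
  | .D, n => 2 * n

/-- The index set `{1, …, N}` of rows and columns, as `Fin N`: the element `i : Fin N` stands for
the index `i + 1`, and `Fin.rev` is the mirror map sending an index `k` to `N + 1 - k`. -/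
abbrev Idx (X : DynkinType) (n : ℕ) : Type := Fin (matSize X n)

/-- `N × N` matrices over `F`. -/
abbrev Mat (X : DynkinType) (n : ℕ) (F : Type*) : Type _ := Matrix (Idx X n) (Idx X n) F

section Positions

variable (X : DynkinType) (n : ℕ)

/-- The positions strictly above the diagonal and strictly left of the anti-diagonal. -/
def upTri : Set (Idx X n × Idx X n) := {x | x.1 < x.2 ∧ x.2 < x.1.rev}

/-- The upper half of the anti-diagonal. -/
def antiDiag : Set (Idx X n × Idx X n) := {x | x.1 < x.2 ∧ x.2 = x.1.rev}

/-- The positions of the positive roots: `upTri` in types `B_n` and `D_n`, and `upTri` together with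
the upper half of the anti-diagonal in type `C_n`. -/
def pos : Set (Idx X n × Idx X n) := {x | x ∈ upTri X n ∨ (X = .C ∧ x ∈ antiDiag X n)}

/-- The number of columns in the left half: `n + 1` in type `B_n`, and `n` in types `C_n`, `D_n`. -/
def halfSize : DynkinType → ℕ → ℕ
  | .B, n => n + 1
  | .C, n => n
  | .D, n => n

/-- The positions of `pos` in the right half, i.e. in columns (counted from `1`) beyond
`halfSize`. -/
def rightPos : Set (Idx X n × Idx X n) := {x | x ∈ pos X n ∧ halfSize X n < (x.2 : ℕ) + 1}

end Positions

section Groups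

variable (X : DynkinType) (n : ℕ) (F : Type*) [Field F]

/-- The Gram matrix of the standard split form: it is supported on the anti-diagonal, with all
entries `1` in the orthogonal types, and with entries `1` in the first `n` rows and `-1` in the
last `n` rows in the symplectic type. -/
def formMatrix : Mat X n F := fun i j =>
  match X with
  | .B => if j = i.rev then 1 else 0
  | .C => if j = i.rev then (if (i : ℕ) < n then 1 else -1) else 0
  | .D => if j = i.rev then 1 else 0

/-- The isometry group of the standard form, i.e. `O_{2n+1}(F)`, `Sp_{2n}(F)` and `O_{2n}^+(F)` in
types `B_n`, `C_n` and `D_n`. -/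
def classicalGroup : Subgroup (GL (Idx X n) F) where
  carrier := {g | (g : Mat X n F)ᵀ * formMatrix X n F * (g : Mat X n F) = formMatrix X n F}
  one_mem' := by simp
  mul_mem' := by
    intro a b ha hb
    simp only [Set.mem_ofPred_eq, Units.val_mul, Matrix.transpose_mul] at ha hb ⊢
    calc (b : Mat X n F)ᵀ * (a : Mat X n F)ᵀ * formMatrix X n F * ((a : Mat X n F) * (b : Mat X n F))
        = (b : Mat X n F)ᵀ * ((a : Mat X n F)ᵀ * formMatrix X n F * (a : Mat X n F))
            * (b : Mat X n F) := by simp only [Matrix.mul_assoc]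
      _ = formMatrix X n F := by rw [ha, hb]
  inv_mem' := by
    intro a ha
    simp only [Set.mem_ofPred_eq] at ha ⊢
    have h1 : (a : Mat X n F) * ((a⁻¹ : GL (Idx X n) F) : Mat X n F) = 1 := by
      rw [← Units.val_mul]; simp
    have h2 : ((a⁻¹ : GL (Idx X n) F) : Mat X n F)ᵀ * (a : Mat X n F)ᵀ = 1 := by
      rw [← Matrix.transpose_mul, h1, Matrix.transpose_one]
    calc ((a⁻¹ : GL (Idx X n) F) : Mat X n F)ᵀ * formMatrix X n F * ((a⁻¹ : GL (Idx X n) F) : Mat X n F)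
        = ((a⁻¹ : GL (Idx X n) F) : Mat X n F)ᵀ *
            ((a : Mat X n F)ᵀ * formMatrix X n F * (a : Mat X n F))
            * ((a⁻¹ : GL (Idx X n) F) : Mat X n F) := by rw [ha]
      _ = (((a⁻¹ : GL (Idx X n) F) : Mat X n F)ᵀ * (a : Mat X n F)ᵀ) * formMatrix X n F
            * ((a : Mat X n F) * ((a⁻¹ : GL (Idx X n) F) : Mat X n F)) := by
          simp only [Matrix.mul_assoc]
      _ = formMatrix X n F := by rw [h1, h2]; simp

/-- A matrix is upper unitriangular. -/
def IsUnitri {X : DynkinType} {n : ℕ} {F : Type*} [Field F] (M : Mat X n F) : Prop :=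
  (∀ i, M i i = 1) ∧ ∀ i j, j < i → M i j = 0

lemma isUnitri_mul {A B : Mat X n F} (hA : IsUnitri A) (hB : IsUnitri B) : IsUnitri (A * B) := by
  refine ⟨fun i => ?_, fun i j hij => ?_⟩
  · rw [Matrix.mul_apply, Finset.sum_eq_single i]
    · rw [hA.1, hB.1, one_mul]
    · intro k _ hk
      rcases lt_or_gt_of_ne hk with h | h
      · rw [hA.2 i k h, zero_mul]
      · rw [hB.2 k i h, mul_zero]
    · simp
  · rw [Matrix.mul_apply]
    refine Finset.sum_eq_zero fun k _ => ?_
    rcases lt_or_ge k i with h | h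
    · rw [hA.2 i k h, zero_mul]
    · rw [hB.2 k j (lt_of_lt_of_le hij h), mul_zero]

lemma isUnitri_inv {g : GL (Idx X n) F} (hg : IsUnitri (g : Mat X n F)) :
    IsUnitri ((g⁻¹ : GL (Idx X n) F) : Mat X n F) := by
  have hmul : (g : Mat X n F) * ((g⁻¹ : GL (Idx X n) F) : Mat X n F) = 1 := by
    rw [← Units.val_mul]; simp
  have htri : Matrix.BlockTriangular (g : Mat X n F) id := fun i j h => hg.2 i j h
  have : Invertible (g : Mat X n F) := (g : (Mat X n F)ˣ).invertible
  have hinv : ((g⁻¹ : GL (Idx X n) F) : Mat X n F) = (g : Mat X n F)⁻¹ := by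
    rw [Matrix.coe_units_inv]
  have htri' : Matrix.BlockTriangular ((g⁻¹ : GL (Idx X n) F) : Mat X n F) id := by
    rw [hinv]
    exact Matrix.blockTriangular_inv_of_blockTriangular htri
  have hlow : ∀ i j, j < i → ((g⁻¹ : GL (Idx X n) F) : Mat X n F) i j = 0 :=
    fun i j h => htri' h
  refine ⟨fun i => ?_, hlow⟩
  have h := congrFun (congrFun hmul i) i
  rw [Matrix.mul_apply, Finset.sum_eq_single i, hg.1, one_mul, Matrix.one_apply_eq] at h
  · exact h
  · intro k _ hk
    rcases lt_or_gt_of_ne hk with h' | h'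
    · rw [hg.2 i k h', zero_mul]
    · rw [hlow k i h', mul_zero]
  · simp

/-- The group of all upper unitriangular `N × N` matrices over `F`. -/
def unitriGroup : Subgroup (GL (Idx X n) F) where
  carrier := {g | IsUnitri (g : Mat X n F)}
  one_mem' := by
    refine ⟨fun i => by simp, fun i j h => ?_⟩
    simp [Matrix.one_apply_ne (ne_of_gt h)]
  mul_mem' := by
    intro a b ha hb
    simpa using isUnitri_mul X n F ha hb
  inv_mem' := by
    intro a ha
    exact isUnitri_inv X n F ha

/-- The group `U` of upper unitriangular matrices in the classical group. For a finite field of odd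
characteristic `p` it is a Sylow `p`-subgroup of the classical group (unitriangular matrices have
determinant `1`, so it does not matter whether the full orthogonal group or the special orthogonal
group is taken). -/
def sylowU : Subgroup (GL (Idx X n) F) := classicalGroup X n F ⊓ unitriGroup X n F

/-- The vector space `V` of matrices supported on `pos`. -/
def V : Submodule F (Mat X n F) where
  carrier := {A | ∀ i j, (i, j) ∉ pos X n → A i j = 0}
  add_mem' := by
    intro a b ha hb i j h
    rw [Matrix.add_apply, ha i j h, hb i j h, add_zero]
  zero_mem' := by intro i j _; rfl
  smul_mem' := by
    intro c a ha i j h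
    rw [Matrix.smul_apply, ha i j h, smul_zero]

open Classical in
/-- The projection `π` onto `V` replacing all entries outside of `pos` by zero. -/
def proj (A : Mat X n F) : V X n F :=
  ⟨fun i j => if (i, j) ∈ pos X n then A i j else 0, fun _ _ h => if_neg h⟩

end Groups

variable {X : DynkinType} {n : ℕ} {F : Type*} [Field F]

/-- The bilinear form `κ(A, B) = ∑ A_{ij} B_{ij}`, i.e. the trace of `Aᵗ B`. -/
def kappa (A B : Mat X n F) : F := (Aᵀ * B).trace

/-- The permutation action of `u` on the labels of linear characters of `V`: writing `[A]` for the
linear character `B ↦ θ (- κ(A, B))` of `V`, one has `[A].u = [π(A u^{-t})]`. -/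
def dot (A : V X n F) (u : GL (Idx X n) F) : V X n F :=
  proj X n F ((A : Mat X n F) * ((u⁻¹ : GL (Idx X n) F) : Mat X n F)ᵀ)

/-- The scalar of the monomial right action: `[A] u = scalar • [A].u`, where the scalar is the value
of the linear character `[A]` at `π(u⁻¹)`. -/
def scalar (θ : AddChar F ℂ) (A : V X n F) (u : GL (Idx X n) F) : ℂ :=
  θ (-kappa (A : Mat X n F) (proj X n F ((u⁻¹ : GL (Idx X n) F) : Mat X n F) : Mat X n F))

lemma kappa_eq_sum (A B : Mat X n F) : kappa A B = ∑ i, ∑ j, A i j * B i j := by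
  simp only [kappa, Matrix.trace, Matrix.diag, Matrix.mul_apply, Matrix.transpose_apply]
  exact Finset.sum_comm

lemma kappa_mul_transpose (A B C : Mat X n F) : kappa (A * Cᵀ) B = kappa A (B * C) := by
  simp only [kappa, Matrix.transpose_mul, Matrix.transpose_transpose]
  rw [Matrix.mul_assoc, Matrix.trace_mul_comm, Matrix.mul_assoc]

lemma proj_of_mem (A : Mat X n F) {i j : Idx X n} (h : (i, j) ∈ pos X n) :
    (proj X n F A : Mat X n F) i j = A i j := if_pos h

lemma proj_of_not_mem (A : Mat X n F) {i j : Idx X n} (h : (i, j) ∉ pos X n) :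
    (proj X n F A : Mat X n F) i j = 0 := if_neg h

lemma pos_lt {i j : Idx X n} (h : (i, j) ∈ pos X n) : i < j := by
  rcases h with h | ⟨_, h⟩ <;> exact h.1

/-- Positions of a row that lie between the diagonal and a position of `pos` belong to `pos`. -/
lemma pos_left {i j k : Idx X n} (h : (i, k) ∈ pos X n) (hij : i < j) (hjk : j ≤ k) :
    (i, j) ∈ pos X n := by
  rcases hjk.lt_or_eq with hlt | rfl
  · left
    rcases h with h | ⟨_, h⟩
    · exact ⟨hij, lt_trans hlt h.2⟩
    · have h2 : k = i.rev := h.2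
      exact ⟨hij, h2 ▸ hlt⟩
  · exact h

/-- Multiplying a matrix of `V` by a lower unitriangular matrix from the right does not create
entries to the right of `pos`. -/
lemma mul_transpose_apply_eq_zero (A : V X n F) {M : Mat X n F} (hM : IsUnitri M) {i j : Idx X n}
    (hij : i < j) (h : (i, j) ∉ pos X n) : ((A : Mat X n F) * Mᵀ) i j = 0 := by
  rw [Matrix.mul_apply]
  refine Finset.sum_eq_zero fun k _ => ?_
  rcases lt_or_ge k j with hk | hk
  · rw [Matrix.transpose_apply, hM.2 j k hk, mul_zero]
  · rw [A.2 i k fun hik => h (pos_left hik hij hk), zero_mul]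

lemma proj_proj_mul_transpose (B : Mat X n F)
    (hB : ∀ i j : Idx X n, i < j → (i, j) ∉ pos X n → B i j = 0)
    {M : Mat X n F} (hM : IsUnitri M) :
    proj X n F ((proj X n F B : Mat X n F) * Mᵀ) = proj X n F (B * Mᵀ) := by
  apply Subtype.ext
  ext i j
  by_cases h : (i, j) ∈ pos X n
  · rw [proj_of_mem _ h, proj_of_mem _ h, Matrix.mul_apply, Matrix.mul_apply]
    refine Finset.sum_congr rfl fun k _ => ?_
    rcases lt_or_ge k j with hk | hk
    · rw [Matrix.transpose_apply, hM.2 j k hk, mul_zero, mul_zero]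
    · by_cases hik : (i, k) ∈ pos X n
      · rw [proj_of_mem _ hik]
      · rw [proj_of_not_mem _ hik, hB i k (lt_of_lt_of_le (pos_lt h) hk) hik]
  · rw [proj_of_not_mem _ h, proj_of_not_mem _ h]

lemma kappa_proj (A : V X n F) (B : Mat X n F) :
    kappa (A : Mat X n F) (proj X n F B : Mat X n F) = kappa (A : Mat X n F) B := by
  rw [kappa_eq_sum, kappa_eq_sum]
  refine Finset.sum_congr rfl fun i _ => Finset.sum_congr rfl fun j _ => ?_
  by_cases h : (i, j) ∈ pos X n
  · rw [proj_of_mem _ h]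
  · rw [A.2 i j h, zero_mul, zero_mul]

lemma kappa_dot (A : V X n F) {M K : Mat X n F} (hM : IsUnitri M) (hK : IsUnitri K) :
    kappa (A : Mat X n F) (K * M)
      = kappa (proj X n F ((A : Mat X n F) * Mᵀ) : Mat X n F) K + kappa (A : Mat X n F) M := by
  have h1 : kappa (A : Mat X n F) (K * M) = kappa ((A : Mat X n F) * Mᵀ) K :=
    (kappa_mul_transpose _ _ _).symm
  have h2 : kappa (A : Mat X n F) M = kappa ((A : Mat X n F) * Mᵀ) 1 := by
    rw [kappa_mul_transpose, Matrix.one_mul]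
  rw [h1, h2, kappa_eq_sum, kappa_eq_sum, kappa_eq_sum, ← Finset.sum_add_distrib]
  refine Finset.sum_congr rfl fun i _ => ?_
  rw [← Finset.sum_add_distrib]
  refine Finset.sum_congr rfl fun j _ => ?_
  by_cases h : (i, j) ∈ pos X n
  · rw [proj_of_mem _ h, Matrix.one_apply_ne (ne_of_lt (pos_lt h)), mul_zero, add_zero]
  · rw [proj_of_not_mem _ h, zero_mul, zero_add]
    rcases lt_trichotomy i j with hij | rfl | hij
    · rw [mul_transpose_apply_eq_zero A hM hij h, zero_mul, zero_mul]
    · rw [hK.1, Matrix.one_apply_eq]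
    · rw [hK.2 i j hij, Matrix.one_apply_ne (ne_of_gt hij)]

lemma dot_one (A : V X n F) : dot A 1 = A := by
  apply Subtype.ext
  ext i j
  by_cases h : (i, j) ∈ pos X n
  · rw [dot, proj_of_mem _ h]; simp
  · rw [dot, proj_of_not_mem _ h, A.2 i j h]

lemma dot_mul (A : V X n F) {g h : GL (Idx X n) F} (hg : g ∈ unitriGroup X n F)
    (hh : h ∈ unitriGroup X n F) : dot A (g * h) = dot (dot A g) h := by
  have hg' : IsUnitri ((g⁻¹ : GL (Idx X n) F) : Mat X n F) := isUnitri_inv X n F hg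
  have hh' : IsUnitri ((h⁻¹ : GL (Idx X n) F) : Mat X n F) := isUnitri_inv X n F hh
  unfold dot
  rw [proj_proj_mul_transpose _ (fun i j hij hp => mul_transpose_apply_eq_zero A hg' hij hp) hh',
    mul_inv_rev, Units.val_mul, Matrix.transpose_mul, Matrix.mul_assoc]

lemma scalar_one (θ : AddChar F ℂ) (A : V X n F) : scalar θ A 1 = 1 := by
  have h : kappa (A : Mat X n F) (1 : Mat X n F) = 0 := by
    rw [kappa_eq_sum]
    refine Finset.sum_eq_zero fun i _ => Finset.sum_eq_zero fun j _ => ?_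
    by_cases h : (i, j) ∈ pos X n
    · rw [Matrix.one_apply_ne (ne_of_lt (pos_lt h)), mul_zero]
    · rw [A.2 i j h, zero_mul]
  rw [scalar, kappa_proj, inv_one, Units.val_one, h, neg_zero, AddChar.map_zero_eq_one]

lemma scalar_mul (θ : AddChar F ℂ) (A : V X n F) {g h : GL (Idx X n) F}
    (hg : g ∈ unitriGroup X n F) (hh : h ∈ unitriGroup X n F) :
    scalar θ A (g * h) = scalar θ A g * scalar θ (dot A g) h := by
  have hg' : IsUnitri ((g⁻¹ : GL (Idx X n) F) : Mat X n F) := isUnitri_inv X n F hg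
  have hh' : IsUnitri ((h⁻¹ : GL (Idx X n) F) : Mat X n F) := isUnitri_inv X n F hh
  unfold scalar
  rw [kappa_proj, kappa_proj, kappa_proj, mul_inv_rev, Units.val_mul, kappa_dot A hg' hh',
    ← AddChar.map_add_eq_mul]
  congr 1
  rw [dot]
  ring

/-- The complex vector space with basis the set of linear characters `[A]` of `V`; the basis
vector `[A]` is `Finsupp.single A 1`. -/
abbrev CharSpace (X : DynkinType) (n : ℕ) (F : Type*) [Field F] : Type _ := V X n F →₀ ℂ

/-- The linear map `[A] ↦ [A] u`. -/
def monomialMap (θ : AddChar F ℂ) (u : GL (Idx X n) F) :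
    CharSpace X n F →ₗ[ℂ] CharSpace X n F :=
  Finsupp.linearCombination ℂ fun A => scalar θ A u • Finsupp.single (dot A u) (1 : ℂ)

lemma monomialMap_single (θ : AddChar F ℂ) (u : GL (Idx X n) F) (A : V X n F) :
    monomialMap θ u (Finsupp.single A 1) = scalar θ A u • Finsupp.single (dot A u) (1 : ℂ) := by
  simp [monomialMap]

/-- The monomial right `ℂU`-module `ℂV̂`, with `[A] u = scalar θ A u • [A].u`. A right module over
the group algebra of `U` is a representation of the opposite group: `MulOpposite.op u` acts as
right multiplication by `u`. -/
def monomialRep (X : DynkinType) (n : ℕ) {F : Type*} [Field F] (θ : AddChar F ℂ) :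
    Representation ℂ (sylowU X n F)ᵐᵒᵖ (CharSpace X n F) where
  toFun u := monomialMap θ (u.unop : GL (Idx X n) F)
  map_one' := by
    refine Finsupp.lhom_ext' fun A => LinearMap.ext_ring ?_
    simp [monomialMap_single, scalar_one, dot_one]
  map_mul' u v := by
    refine Finsupp.lhom_ext' fun A => LinearMap.ext_ring ?_
    have hu := u.unop.2.2
    have hv := v.unop.2.2
    simp only [LinearMap.comp_apply, Finsupp.lsingle_apply, Module.End.mul_apply,
      MulOpposite.unop_mul, Subgroup.coe_mul, monomialMap_single, map_smul]
    rw [scalar_mul θ A hv hu, dot_mul A hv hu, smul_smul]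

/-- The `U`-orbit of `[A]`, as a set of labels. -/
def orbit (A : V X n F) : Set (V X n F) :=
  {B | ∃ u ∈ sylowU X n F, B = dot A u}

/-- The orbit module of `[A]`: the span of the characters `[B]` in the orbit of `[A]`. -/
def orbitModule (θ : AddChar F ℂ) (A : V X n F) : Subrepresentation (monomialRep X n θ) where
  toSubmodule := Submodule.span ℂ ((fun B : V X n F => Finsupp.single B (1 : ℂ)) '' orbit A)
  apply_mem_toSubmodule u v hv := by
    induction hv using Submodule.span_induction with
    | mem x hx =>
      obtain ⟨B, ⟨g, hg, rfl⟩, rfl⟩ := hx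
      change monomialMap θ (u.unop : GL (Idx X n) F) (Finsupp.single (dot A g) 1) ∈ _
      rw [monomialMap_single]
      refine Submodule.smul_mem _ _ (Submodule.subset_span
        ⟨_, ⟨g * (u.unop : GL (Idx X n) F), mul_mem hg u.unop.2, ?_⟩, rfl⟩)
      rw [dot_mul A hg.2 u.unop.2.2]
    | zero => simp
    | add x y _ _ hx hy => rw [map_add]; exact add_mem hx hy
    | smul c x _ hx => rw [map_smul]; exact Submodule.smul_mem _ _ hx

/-- The main conditions of `A`: the positions of the rightmost nonzero entries of its nonzero
rows. -/
def mainConditions (A : V X n F) : Set (Idx X n × Idx X n) :=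
  {x | x ∈ pos X n ∧ (A : Mat X n F) x.1 x.2 ≠ 0 ∧ ∀ k, x.2 < k → (A : Mat X n F) x.1 k = 0}

/-- The right main conditions of `A`. -/
def rightMainConditions (A : V X n F) : Set (Idx X n × Idx X n) :=
  mainConditions A ∩ rightPos X n

/-- The arm of the position `(i, j)`: the positions of `upTri` in the row mirror to column `j`. -/
def arm (x : Idx X n × Idx X n) : Set (Idx X n × Idx X n) :=
  {y | y ∈ upTri X n ∧ y.1 = x.2.rev}

/-- The leg of the position `(i, j)`: the positions of `upTri` in column `j` below `(i, j)`. -/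
def leg (x : Idx X n × Idx X n) : Set (Idx X n × Idx X n) :=
  {y | y ∈ upTri X n ∧ y.2 = x.2 ∧ x.1 < y.1}

/-- The anti-diagonal positions in the columns of those right main conditions of `A` that lie
strictly left of the anti-diagonal. -/
def antiDiagLimb (A : V X n F) : Set (Idx X n × Idx X n) :=
  {y | y ∈ antiDiag X n ∧ ∃ x ∈ rightMainConditions A ∩ upTri X n, y = (x.2.rev, x.2)}

/-- The limb of `A`: the union of arms and legs of the main conditions of `A`, together with
`antiDiagLimb A` in type `C_n`. -/
def limb (A : V X n F) : Set (Idx X n × Idx X n) :=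
  {y | (∃ x ∈ mainConditions A, y ∈ arm x ∪ leg x) ∨ (X = .C ∧ y ∈ antiDiagLimb A)}

/-- `[A]` is main separated: no main condition of `A` lies on the limb of `A`. -/
def IsMainSeparated (A : V X n F) : Prop := limb A ∩ mainConditions A = ∅

/-- `ρ` is an (irreducible) constituent of the representation `σ`: it is isomorphic to a
subrepresentation of `σ`. For complex representations of finite groups, which are completely
reducible, this says that `ρ` is isomorphic to a composition factor of `σ`. -/
def IsConstituent {G W₁ W₂ : Type*} [Monoid G] [AddCommMonoid W₁] [Module ℂ W₁] [AddCommMonoid W₂]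
    [Module ℂ W₂] (ρ : Representation ℂ G W₁) (σ : Representation ℂ G W₂) : Prop :=
  ∃ S : Subrepresentation σ, Nonempty (Representation.Equiv ρ S.toRepresentation)

end SylowClassical

end

/-! By Frobenius reciprocity, an irreducible `W` embeds in the orbit module of `[A]` as soon as some
non-zero functional on `W` transforms under the stabilizer of `[A]` through the linear character
`scalar θ A`. So a main separated `A` is needed for which the twisted sum `stabSum` over the full
stabilizer is non-zero on `W`.

Such an `A` is built entry by entry, top row first and each row from right to left (`rank`). After
the positions of rank below `m` have been treated, `stabSum θ ρ A m` runs only over the stabilizer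
elements whose inverses vanish at all later positions. It starts as the identity operator, at `A =
0`, and stays non-zero at each position `x`: - If `x` is blocked by an earlier main condition, the
stabilizer equations force the entry of `u⁻¹` at `x` to vanish (`IsBlocked.apply_eq_zero`).
Admitting rank `rank x` adds no elements, and `A` is kept. - Otherwise the entry of `A` at `x` is
free. Changing it does not change the stabilizer among the admitted elements
(`dot_add_singleV_eq_self_iff`), and by orthogonality of characters the sums for all values `a` add
up to `|F|` times the previous one (`sum_stabSum_add_singleV`), so some `a` works.

Thus no main condition is ever blocked, and this gives main separation
(`isMainSeparated_of_not_isBlocked`). -/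

namespace SylowClassical

noncomputable section

/-! ### Mirror symmetry of the entries of elements of `U`. -/

section FormRelations

variable {X : DynkinType} {n : ℕ} {F : Type*} [Field F]

lemma formMatrix_apply_of_ne {i j : Idx X n} (h : j ≠ i.rev) : formMatrix X n F i j = 0 := by
  cases X <;> simp [formMatrix, h]

lemma formMatrix_apply_rev_ne_zero (i : Idx X n) : formMatrix X n F i i.rev ≠ 0 := by
  cases X
  · simp [formMatrix]
  · by_cases h : (i : ℕ) < n <;> simp [formMatrix, h]
  · simp [formMatrix]

lemma formMatrix_apply_rev_of_ne_C (hX : X ≠ .C) (i : Idx X n) :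
    formMatrix X n F i i.rev = 1 := by
  cases X <;> simp_all [formMatrix]

lemma formMatrix_mul_self :
    ∃ s : F, s * s = 1 ∧ formMatrix X n F * formMatrix X n F = s • (1 : Mat X n F) := by
  have key : ∀ i j : Idx X n, (formMatrix X n F * formMatrix X n F) i j =
      formMatrix X n F i i.rev * formMatrix X n F i.rev j := by
    intro i j
    rw [Matrix.mul_apply, Finset.sum_eq_single i.rev]
    · intro k _ hk
      rw [formMatrix_apply_of_ne hk, zero_mul]
    · simp
  have off : ∀ i j : Idx X n, i ≠ j → formMatrix X n F i.rev j = 0 := fun i j hij =>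
    formMatrix_apply_of_ne (by simpa using hij.symm)
  cases X with
  | B =>
    refine ⟨1, one_mul 1, Matrix.ext fun i j => ?_⟩
    rw [key]
    rcases eq_or_ne i j with rfl | hij
    · simp [formMatrix]
    · rw [off i j hij]; simp [hij]
  | C =>
    refine ⟨-1, by ring, Matrix.ext fun i j => ?_⟩
    rw [key]
    rcases eq_or_ne i j with rfl | hij
    · have hi : (i : ℕ) < 2 * n := i.2
      have hr : (i.rev : ℕ) = 2 * n - (i + 1) := Fin.val_rev i
      by_cases h : (i : ℕ) < n
      · have h' : ¬ (i.rev : ℕ) < n := by omega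
        simp only [formMatrix, Fin.rev_rev, h, h', if_true, if_false]; simp
      · have h' : (i.rev : ℕ) < n := by omega
        simp only [formMatrix, Fin.rev_rev, h, h', if_true, if_false]; simp
    · rw [off i j hij]; simp [hij]
  | D =>
    refine ⟨1, one_mul 1, Matrix.ext fun i j => ?_⟩
    rw [key]
    rcases eq_or_ne i j with rfl | hij
    · simp [formMatrix]
    · rw [off i j hij]; simp [hij]

/-- Since `J * J = s • 1` with `s * s = 1`, the relation `gᵀ J g = J` makes `s • (J gᵀ J)` a left
inverse of `g`, hence also a right inverse. -/
lemma mul_formMatrix_mul_transpose {g : GL (Idx X n) F} (hg : g ∈ classicalGroup X n F) :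
    (g : Mat X n F) * formMatrix X n F * (g : Mat X n F)ᵀ = formMatrix X n F := by
  obtain ⟨s, hs, hJ⟩ := formMatrix_mul_self (X := X) (n := n) (F := F)
  have h1 : (g : Mat X n F)ᵀ * formMatrix X n F * (g : Mat X n F) = formMatrix X n F := hg
  generalize (g : Mat X n F) = M at *
  generalize formMatrix X n F = J at *
  have h2 : (s • (J * Mᵀ * J)) * M = 1 := by
    rw [Matrix.smul_mul, Matrix.mul_assoc J, Matrix.mul_assoc J, h1, hJ, smul_smul, hs, one_smul]
  have h3 : M * (s • (J * Mᵀ * J)) = 1 := mul_eq_one_comm.mp h2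
  calc M * J * Mᵀ = (s * s) • (M * J * Mᵀ) := by rw [hs, one_smul]
    _ = s • (M * J * Mᵀ * (s • (1 : Mat X n F))) := by
        rw [Matrix.mul_smul, Matrix.mul_one, smul_smul]
    _ = (M * (s • (J * Mᵀ * J))) * J := by
        rw [← hJ, Matrix.mul_smul, Matrix.smul_mul]; simp only [Matrix.mul_assoc]
    _ = J := by rw [h3, Matrix.one_mul]

/-- If row `a` of an isometry vanishes strictly between the columns `a` and `c`, then its entry at
`(a, c)` is up to a sign the entry at the mirror position. -/
lemma mirror_entry {g : GL (Idx X n) F} (hg : g ∈ sylowU X n F) {a c : Idx X n} (hac : a < c)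
    (h0 : ∀ e, a < e → e < c → (g : Mat X n F) a e = 0) :
    formMatrix X n F a a.rev * (g : Mat X n F) c.rev a.rev
      + formMatrix X n F c c.rev * (g : Mat X n F) a c = 0 := by
  have hu : IsUnitri (g : Mat X n F) := hg.2
  -- In this entry of `g J gᵀ = J`, unitriangularity kills the terms with `e.rev < a` or `c <
  -- e.rev`, and `h0` those in between. Only `e = a.rev` and `e = c.rev` remain.
  have h := congrFun (congrFun (mul_formMatrix_mul_transpose hg.1) a) c.rev
  rw [formMatrix_apply_of_ne (fun h => hac.ne' (Fin.rev_injective h)), Matrix.mul_apply] at h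
  have h2 : ∀ e, ((g : Mat X n F) * formMatrix X n F) a e =
      (g : Mat X n F) a e.rev * formMatrix X n F e.rev e := by
    intro e
    rw [Matrix.mul_apply, Finset.sum_eq_single e.rev]
    · intro k _ hk
      rw [formMatrix_apply_of_ne (fun h => hk (by rw [h, Fin.rev_rev])), mul_zero]
    · simp
  have h3 : ∀ e, e ≠ a.rev → e ≠ c.rev →
      ((g : Mat X n F) * formMatrix X n F) a e * (g : Mat X n F)ᵀ e c.rev = 0 := by
    intro e hea hec
    rw [h2, Matrix.transpose_apply]
    have hea' : e.rev ≠ a := fun h => hea (by rw [← h, Fin.rev_rev])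
    have hec' : e.rev ≠ c := fun h => hec (by rw [← h, Fin.rev_rev])
    rcases lt_or_gt_of_ne hea' with h | h
    · rw [hu.2 _ _ h, zero_mul, zero_mul]
    · rcases lt_or_gt_of_ne hec' with h' | h'
      · rw [h0 _ h h', zero_mul, zero_mul]
      · rw [hu.2 c.rev e (by simpa using Fin.rev_lt_rev.mpr h'), mul_zero]
  rw [Finset.sum_eq_add_of_mem a.rev c.rev (Finset.mem_univ _) (Finset.mem_univ _)
    (fun h => hac.ne (Fin.rev_injective h)) (fun e _ he => h3 e he.1 he.2), h2, h2,
    Matrix.transpose_apply, Matrix.transpose_apply, hu.1, Fin.rev_rev, Fin.rev_rev, hu.1] at h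
  linear_combination h

lemma apply_eq_zero_of_mirror {g : GL (Idx X n) F} (hg : g ∈ sylowU X n F) {a c : Idx X n}
    (hac : a < c) (h0 : ∀ e, a < e → e < c → (g : Mat X n F) a e = 0)
    (h : (g : Mat X n F) c.rev a.rev = 0) : (g : Mat X n F) a c = 0 := by
  have := mirror_entry hg hac h0
  rw [h, mul_zero, zero_add] at this
  exact (mul_eq_zero.mp this).resolve_left (formMatrix_apply_rev_ne_zero c)

lemma mirror_apply_eq_zero {g : GL (Idx X n) F} (hg : g ∈ sylowU X n F) {a c : Idx X n}
    (hac : a < c) (h0 : ∀ e, a < e → e ≤ c → (g : Mat X n F) a e = 0) :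
    (g : Mat X n F) c.rev a.rev = 0 := by
  have := mirror_entry hg hac (fun e h1 h2 => h0 e h1 h2.le)
  rw [h0 c hac le_rfl, mul_zero, add_zero] at this
  exact (mul_eq_zero.mp this).resolve_left (formMatrix_apply_rev_ne_zero a)

/-- For a set of indices stable under the mirror map, an element of `U` whose entries at the positions
of `pos` in these rows vanish is trivial in the block of these rows and columns. -/
lemma inner_eq_zero (h2 : (2 : F) ≠ 0) {g : GL (Idx X n) F} (hg : g ∈ sylowU X n F)
    {P : Idx X n → Prop} (hP : ∀ d, P d.rev → P d)
    (h0 : ∀ d c, P d → (d, c) ∈ pos X n → (g : Mat X n F) d c = 0)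
    {d c : Idx X n} (hd : P d) (hc : P c) (hdc : d < c) : (g : Mat X n F) d c = 0 := by
  by_cases hp : (d, c) ∈ pos X n
  · exact h0 d c hd hp
  rcases lt_trichotomy c d.rev with h | h | h
  · exact absurd (Or.inl ⟨hdc, h⟩) hp
  · subst h
    have hX : X ≠ .C := fun hX => hp (Or.inr ⟨hX, hdc, rfl⟩)
    -- An anti-diagonal position is its own mirror, so in the orthogonal types the relation says
    -- that twice the entry is zero.
    have := mirror_entry hg hdc (fun e h1 h2 => h0 d e hd (Or.inl ⟨h1, h2⟩))
    rw [Fin.rev_rev, formMatrix_apply_rev_of_ne_C hX] at this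
    have hX' := formMatrix_apply_rev_of_ne_C (F := F) hX d.rev
    rw [Fin.rev_rev] at hX'
    rw [hX'] at this
    have h3 : (2 : F) * (g : Mat X n F) d d.rev = 0 := by linear_combination this
    exact (mul_eq_zero.mp h3).resolve_left h2
  -- Beyond the anti-diagonal: the mirror position `(c.rev, d.rev)` lies in the triangle, in a row
  -- to which `h0` applies.
  · have hlt : c.rev < d.rev := Fin.rev_lt_rev.mpr hdc
    have := mirror_apply_eq_zero hg hlt (fun e h1 h2 => h0 c.rev e
      (hP _ (by rwa [Fin.rev_rev])) (Or.inl ⟨h1, by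
        rw [Fin.rev_rev]; exact lt_of_le_of_lt h2 h⟩))
    rwa [Fin.rev_rev, Fin.rev_rev] at this

end FormRelations


/-! ### The order in which positions are treated. -/

section Order

variable {X : DynkinType} {n : ℕ}

/-- The rank of a position when positions are listed row by row from the top, and each row from the
right to the left. -/
def rank (x : Idx X n × Idx X n) : ℕ := x.1 * matSize X n + x.2.rev

lemma rank_lt_of_row_lt {x y : Idx X n × Idx X n} (h : x.1 < y.1) : rank x < rank y := by
  have h1 : (x.1 : ℕ) + 1 ≤ y.1 := h
  have h2 := x.2.rev.2
  have h3 := Nat.mul_le_mul_right (matSize X n) h1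
  rw [add_mul, one_mul] at h3
  unfold rank
  omega

lemma rank_lt_of_col_lt {i j k : Idx X n} (h : k < j) : rank (i, j) < rank (i, k) := by
  have := Fin.rev_lt_rev.mpr h
  exact Nat.add_lt_add_left this _

lemma rank_injective : Function.Injective (rank : Idx X n × Idx X n → ℕ) := by
  intro x y h
  have h1 : x.1 = y.1 := by
    rcases lt_trichotomy x.1 y.1 with h1 | h1 | h1
    · exact absurd h (rank_lt_of_row_lt h1).ne
    · exact h1
    · exact absurd h (rank_lt_of_row_lt h1).ne'
  obtain ⟨i, j⟩ := x
  obtain ⟨i', k⟩ := y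
  obtain rfl : i = i' := h1
  rcases lt_trichotomy j k with h2 | h2 | h2
  · exact absurd h (rank_lt_of_col_lt h2).ne'
  · rw [h2]
  · exact absurd h (rank_lt_of_col_lt h2).ne

lemma rank_lt (x : Idx X n × Idx X n) : rank x < matSize X n * matSize X n := by
  have h1 : (x.1 : ℕ) + 1 ≤ matSize X n := x.1.2
  have h2 := x.2.rev.2
  have h3 := Nat.mul_le_mul_right (matSize X n) h1
  rw [add_mul, one_mul] at h3
  unfold rank
  omega

end Order

variable {X : DynkinType} {n : ℕ} {F : Type*} [Field F]

/-- The matrix of `V` with the single entry `a` at the position `x`. -/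
def singleV {x : Idx X n × Idx X n} (hx : x ∈ pos X n) (a : F) : V X n F :=
  ⟨Matrix.single x.1 x.2 a, fun i j h => by
    refine Matrix.single_apply_of_ne _ _ _ _ _ ?_
    rintro ⟨rfl, rfl⟩
    exact h hx⟩

/-! ### Stabilizer equations and the effect of changing one entry of a label. -/

section Stabilizer

lemma dot_eq_self_iff {A : V X n F} {u : GL (Idx X n) F} :
    dot A u = A ↔ ∀ i d, (i, d) ∈ pos X n →
      ∑ c, (A : Mat X n F) i c * ((u⁻¹ : GL (Idx X n) F) : Mat X n F) d c = (A : Mat X n F) i d := by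
  constructor
  · intro h i d hp
    have := congrArg (fun B : V X n F => (B : Mat X n F) i d) h
    simpa only [dot, proj_of_mem _ hp, Matrix.mul_apply, Matrix.transpose_apply] using this
  · intro h
    refine Subtype.ext (Matrix.ext fun i d => ?_)
    by_cases hp : (i, d) ∈ pos X n
    · rw [dot, proj_of_mem _ hp, Matrix.mul_apply, ← h i d hp]; rfl
    · rw [dot, proj_of_not_mem _ hp, A.2 i d hp]

/-- The entries of `u⁻¹` at the positions of `pos` of rank at least `m` vanish. -/
def VanishesFrom (m : ℕ) (u : GL (Idx X n) F) : Prop :=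
  ∀ y ∈ pos X n, m ≤ rank y → ((u⁻¹ : GL (Idx X n) F) : Mat X n F) y.1 y.2 = 0

lemma VanishesFrom.apply_of_col_lt {i j k : Idx X n} {u : GL (Idx X n) F}
    (h : VanishesFrom (rank (i, j) + 1) u) (hij : (i, j) ∈ pos X n) (hik : i < k) (hkj : k < j) :
    ((u⁻¹ : GL (Idx X n) F) : Mat X n F) i k = 0 :=
  h (i, k) (pos_left hij hik hkj.le) (rank_lt_of_col_lt hkj)

lemma pos_le_rev {i j : Idx X n} (h : (i, j) ∈ pos X n) : j ≤ i.rev := by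
  rcases h with h | ⟨_, h⟩
  · exact h.2.le
  · exact h.2.le

/-- An element of `U` vanishing below row `i` is trivial in the indices strictly between `i` and its
mirror. -/
lemma VanishesFrom.inner_apply (h2 : (2 : F) ≠ 0) {x : Idx X n × Idx X n} {u : GL (Idx X n) F}
    (hu : u ∈ sylowU X n F) (h : VanishesFrom (rank x + 1) u) {d c : Idx X n}
    (hd : x.1 < d) (hdc : d < c) (hc : c < x.1.rev) :
    ((u⁻¹ : GL (Idx X n) F) : Mat X n F) d c = 0 := by
  refine inner_eq_zero h2 (inv_mem hu) (P := fun d => x.1 < d ∧ d < x.1.rev) ?_ ?_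
    ⟨hd, hdc.trans hc⟩ ⟨hd.trans hdc, hc⟩ hdc
  · rintro d ⟨h1, h2⟩
    exact ⟨Fin.rev_lt_rev.mp h2, by simpa using Fin.rev_lt_rev.mpr h1⟩
  · intro d c hd hp
    exact h (d, c) hp (rank_lt_of_row_lt hd.1)

/-- The condition that a stabilizer imposes in the column of the rightmost nonzero entry of a row. -/
lemma apply_eq_zero_of_dot_eq_self {A : V X n F} {u : GL (Idx X n) F} (hA : dot A u = A)
    (hu : u ∈ sylowU X n F) {i j d : Idx X n} (hij : (i, j) ∈ mainConditions A) (hid : i < d)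
    (hdj : d < j)
    (h0 : ∀ c, d < c → c < j → ((u⁻¹ : GL (Idx X n) F) : Mat X n F) d c = 0) :
    ((u⁻¹ : GL (Idx X n) F) : Mat X n F) d j = 0 := by
  have hg : IsUnitri ((u⁻¹ : GL (Idx X n) F) : Mat X n F) := (inv_mem hu).2
  obtain ⟨hp, hne, hmax⟩ := hij
  -- The term `c = d` reproduces the right-hand side, and the only other surviving term is the main
  -- entry `A i j` times the entry of `u⁻¹` at `(d, j)`.
  have h := dot_eq_self_iff.mp hA i d (pos_left hp hid hdj.le)
  rw [Finset.sum_eq_add_of_mem d j (Finset.mem_univ _) (Finset.mem_univ _) hdj.ne, hg.1,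
    mul_one, add_eq_left] at h
  · exact (mul_eq_zero.mp h).resolve_left hne
  · rintro c - ⟨hcd, hcj⟩
    rcases lt_or_gt_of_ne hcd with h1 | h1
    · rw [hg.2 _ _ h1, mul_zero]
    · rcases lt_or_gt_of_ne hcj with h3 | h3
      · rw [h0 c h1 h3, mul_zero]
      · rw [hmax c h3, zero_mul]

/-- `x` lies in the column of a main condition of `A` in a higher row, or in the row mirror to that
column. -/
def IsBlocked (A : V X n F) (x : Idx X n × Idx X n) : Prop :=
  ∃ y ∈ mainConditions A, y.1 < x.1 ∧ (y.2 = x.2 ∨ y.2 = x.1.rev)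

/-- A main condition in the column of `x` gives a stabilizer equation for the entry at `x` itself;
one in the column `x.1.rev` gives an equation for the mirror entry, which equals the entry at `x` up
to sign. -/
lemma IsBlocked.apply_eq_zero (h2 : (2 : F) ≠ 0) {A : V X n F} {x : Idx X n × Idx X n}
    (hx : x ∈ pos X n) (hb : IsBlocked A x) {u : GL (Idx X n) F} (hu : u ∈ sylowU X n F)
    (hA : dot A u = A) (h : VanishesFrom (rank x + 1) u) :
    ((u⁻¹ : GL (Idx X n) F) : Mat X n F) x.1 x.2 = 0 := by
  obtain ⟨⟨i, j⟩, hy, hlt, hcol⟩ := hb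
  obtain ⟨i₀, j₀⟩ := x
  dsimp only at hlt hcol ⊢
  have hij₀ : i₀ < j₀ := pos_lt hx
  rcases eq_or_ne j j₀ with rfl | hne
  · exact apply_eq_zero_of_dot_eq_self hA hu hy hlt hij₀
      fun c h1 h3 => h.apply_of_col_lt hx h1 h3
  · obtain rfl : j = i₀.rev := hcol.resolve_left hne
    have hj₀ : j₀ < i₀.rev := lt_of_le_of_ne (pos_le_rev hx) hne.symm
    have hd : i₀ < j₀.rev := by simpa using Fin.rev_lt_rev.mpr hj₀
    refine apply_eq_zero_of_mirror (inv_mem hu) hij₀ (fun e h1 h3 => h.apply_of_col_lt hx h1 h3) ?_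
    exact apply_eq_zero_of_dot_eq_self hA hu hy (hlt.trans hd) (Fin.rev_lt_rev.mpr hij₀)
      fun c h1 h3 => h.inner_apply h2 hu hd h1 h3

lemma dot_add (A B : V X n F) (u : GL (Idx X n) F) : dot (A + B) u = dot A u + dot B u := by
  refine Subtype.ext (Matrix.ext fun i j => ?_)
  by_cases hp : (i, j) ∈ pos X n
  · simp only [dot, Submodule.coe_add, Matrix.add_apply, proj_of_mem _ hp, Matrix.add_mul]
  · simp only [dot, Submodule.coe_add, Matrix.add_apply, proj_of_not_mem _ hp, add_zero]

/-- The action could only create entries to the left of `x` in its row, with coefficients from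
column `x.2` of `u⁻¹` in the rows strictly between `x.1` and `x.2`. These vanish, by triviality of
the inner block or, for anti-diagonal `x`, by mirroring into row `x.1`. -/
lemma dot_singleV (h2 : (2 : F) ≠ 0) {x : Idx X n × Idx X n} (hx : x ∈ pos X n) (a : F)
    {u : GL (Idx X n) F} (hu : u ∈ sylowU X n F) (h : VanishesFrom (rank x + 1) u) :
    dot (singleV hx a) u = singleV hx a := by
  have hg : IsUnitri ((u⁻¹ : GL (Idx X n) F) : Mat X n F) := (inv_mem hu).2
  obtain ⟨i₀, j₀⟩ := x
  refine dot_eq_self_iff.mpr fun i d hp => ?_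
  simp only [singleV]
  by_cases hi : i₀ = i
  swap
  · rw [Matrix.single_apply_of_row_ne hi]
    exact Finset.sum_eq_zero fun c _ => by rw [Matrix.single_apply_of_row_ne hi, zero_mul]
  subst hi
  rw [Finset.sum_eq_single j₀ (fun c _ hc => by
      rw [Matrix.single_apply_of_col_ne _ _ hc.symm, zero_mul]) (by simp), Matrix.single_apply_same]
  rcases lt_trichotomy d j₀ with hd | rfl | hd
  · rw [Matrix.single_apply_of_col_ne _ _ hd.ne']
    have hid : i₀ < d := pos_lt hp
    rcases (pos_le_rev hx).lt_or_eq with hj | hj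
    · rw [h.inner_apply h2 hu hid hd hj, mul_zero]
    -- Column `i₀.rev` lies outside the inner block; the mirror of `(d, i₀.rev)` is `(i₀, d.rev)`,
    -- which lies to the left of `x` and so has larger rank.
    · replace hj : j₀ = i₀.rev := hj
      have h1 : i₀ < d.rev := by
        rw [hj] at hd
        simpa using Fin.rev_lt_rev.mpr hd
      have h3 : d.rev < j₀ := by rw [hj]; exact Fin.rev_lt_rev.mpr hid
      have := mirror_apply_eq_zero (inv_mem hu) h1
        (fun e he he' => h.apply_of_col_lt hx he (he'.trans_lt h3))
      rw [Fin.rev_rev, ← hj] at this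
      rw [this, mul_zero]
  · rw [hg.1, mul_one, Matrix.single_apply_same]
  · rw [hg.2 _ _ hd, mul_zero, Matrix.single_apply_of_col_ne _ _ hd.ne]

lemma dot_add_singleV_eq_self_iff (h2 : (2 : F) ≠ 0) (A : V X n F) {x : Idx X n × Idx X n}
    (hx : x ∈ pos X n) (a : F) {u : GL (Idx X n) F} (hu : u ∈ sylowU X n F)
    (h : VanishesFrom (rank x + 1) u) :
    dot (A + singleV hx a) u = A + singleV hx a ↔ dot A u = A := by
  rw [dot_add, dot_singleV h2 hx a hu h, add_left_inj]

lemma vanishesFrom_succ_iff {m : ℕ} {u : GL (Idx X n) F} :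
    VanishesFrom m u ↔ VanishesFrom (m + 1) u ∧
      ∀ x ∈ pos X n, rank x = m → ((u⁻¹ : GL (Idx X n) F) : Mat X n F) x.1 x.2 = 0 := by
  constructor
  · exact fun h => ⟨fun y hy hm => h y hy (by omega), fun x hx hm => h x hx hm.ge⟩
  · rintro ⟨h1, h3⟩ y hy hm
    rcases hm.eq_or_lt with h | h
    · exact h3 y hy h.symm
    · exact h1 y hy h

lemma vanishesFrom_rank_iff {x : Idx X n × Idx X n} (hx : x ∈ pos X n) {u : GL (Idx X n) F} :
    VanishesFrom (rank x) u ↔ VanishesFrom (rank x + 1) u ∧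
      ((u⁻¹ : GL (Idx X n) F) : Mat X n F) x.1 x.2 = 0 := by
  rw [vanishesFrom_succ_iff]
  refine and_congr_right fun _ => ⟨fun h => h x hx rfl, fun h y _ hyx => ?_⟩
  rw [rank_injective hyx]
  exact h

lemma VanishesFrom.eq_one (h2 : (2 : F) ≠ 0) {u : GL (Idx X n) F} (hu : u ∈ sylowU X n F)
    (h : VanishesFrom 0 u) : u = 1 := by
  have hg : IsUnitri ((u⁻¹ : GL (Idx X n) F) : Mat X n F) := (inv_mem hu).2
  rw [← inv_eq_one]
  refine Units.ext (Matrix.ext fun i j => ?_)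
  rcases lt_trichotomy i j with hij | rfl | hij
  · rw [Units.val_one, Matrix.one_apply_ne hij.ne]
    exact inner_eq_zero h2 (inv_mem hu) (P := fun _ => True) (fun _ h => h)
      (fun d c _ hp => h (d, c) hp (Nat.zero_le _)) trivial trivial hij
  · rw [hg.1, Units.val_one, Matrix.one_apply_eq]
  · rw [hg.2 _ _ hij, Units.val_one, Matrix.one_apply_ne hij.ne']

lemma scalar_add_singleV (θ : AddChar F ℂ) (A : V X n F) {x : Idx X n × Idx X n}
    (hx : x ∈ pos X n) (a : F) (u : GL (Idx X n) F) :
    scalar θ (A + singleV hx a) u =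
      scalar θ A u * θ (-(a * ((u⁻¹ : GL (Idx X n) F) : Mat X n F) x.1 x.2)) := by
  unfold scalar
  rw [kappa_proj, kappa_proj, ← AddChar.map_add_eq_mul]
  congr 1
  generalize ((u⁻¹ : GL (Idx X n) F) : Mat X n F) = g
  have : kappa (singleV hx a : Mat X n F) g = a * g x.1 x.2 := by
    rw [kappa_eq_sum, Finset.sum_eq_single x.1, Finset.sum_eq_single x.2]
    · simp [singleV]
    · intro c _ hc
      simp only [singleV]
      rw [Matrix.single_apply_of_col_ne _ _ hc.symm, zero_mul]
    · simp
    · intro i _ hi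
      simp only [singleV]
      exact Finset.sum_eq_zero fun c _ => by rw [Matrix.single_apply_of_row_ne hi.symm, zero_mul]
    · simp
  rw [← this, kappa_eq_sum, kappa_eq_sum, kappa_eq_sum]
  simp only [Submodule.coe_add, Matrix.add_apply, add_mul, Finset.sum_add_distrib]
  ring

lemma scalar_ne_zero (θ : AddChar F ℂ) (A : V X n F) (u : GL (Idx X n) F) :
    scalar θ A u ≠ 0 := (θ.val_isUnit _).ne_zero

end Stabilizer


end

end SylowClassical

namespace SylowClassical

noncomputable section

variable {X : DynkinType} {n : ℕ} {F : Type*} [Field F]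
variable {W : Type*} [AddCommGroup W] [Module ℂ W]

/-! ### Twisted sums over partial stabilizers. -/

section StabSum

variable [Fintype (sylowU X n F)]

open Classical in
/-- The sum of `(scalar θ A u)⁻¹ u` over the elements `u` of the stabilizer of `[A]` for which the
entries of `u⁻¹` at the positions of rank at least `m` vanish. -/
def stabSum (θ : AddChar F ℂ) (ρ : Representation ℂ (sylowU X n F)ᵐᵒᵖ W) (A : V X n F) (m : ℕ) :
    W →ₗ[ℂ] W :=
  ∑ u : sylowU X n F, if dot A (u : GL (Idx X n) F) = A ∧ VanishesFrom m (u : GL (Idx X n) F)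
    then (scalar θ A (u : GL (Idx X n) F))⁻¹ • ρ (MulOpposite.op u) else 0

lemma stabSum_congr (θ : AddChar F ℂ) (ρ : Representation ℂ (sylowU X n F)ᵐᵒᵖ W) (A : V X n F)
    {m m' : ℕ} (h : ∀ u ∈ sylowU X n F, dot A u = A → (VanishesFrom m u ↔ VanishesFrom m' u)) :
    stabSum θ ρ A m = stabSum θ ρ A m' := by
  classical
  refine Finset.sum_congr rfl fun u _ => if_congr ?_ rfl rfl
  exact and_congr_right fun hA => h u u.2 hA

lemma stabSum_zero_zero (h2 : (2 : F) ≠ 0) (θ : AddChar F ℂ)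
    (ρ : Representation ℂ (sylowU X n F)ᵐᵒᵖ W) : stabSum θ ρ 0 0 = 1 := by
  classical
  rw [stabSum, Finset.sum_eq_single 1]
  · have hv : VanishesFrom 0 (1 : GL (Idx X n) F) := fun y hy _ => by
      rw [inv_one, Units.val_one, Matrix.one_apply_ne (pos_lt hy).ne]
    rw [Subgroup.coe_one, if_pos ⟨dot_one 0, hv⟩, scalar_one, inv_one, one_smul,
      MulOpposite.op_one, map_one]
  · intro u _ hu
    refine if_neg fun h => hu (Subtype.ext ?_)
    exact h.2.eq_one h2 u.2
  · simp

/-- All labels `A + singleV hx a` share the same group elements, and their scalars differ by `θ` of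
a multiple of the entry of `u⁻¹` at `x`. Summing over `a` detects whether this entry is zero. -/
lemma sum_stabSum_add_singleV [Fintype F] (h2 : (2 : F) ≠ 0) {θ : AddChar F ℂ} (hθ : θ ≠ 1)
    (ρ : Representation ℂ (sylowU X n F)ᵐᵒᵖ W) (A : V X n F) {x : Idx X n × Idx X n}
    (hx : x ∈ pos X n) :
    ∑ a : F, stabSum θ ρ (A + singleV hx a) (rank x + 1) =
      (Fintype.card F : ℂ) • stabSum θ ρ A (rank x) := by
  classical
  unfold stabSum
  rw [Finset.sum_comm, Finset.smul_sum]
  refine Finset.sum_congr rfl fun u _ => ?_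
  by_cases hv : VanishesFrom (rank x + 1) (u : GL (Idx X n) F)
  swap
  · rw [Finset.sum_eq_zero fun a _ => if_neg fun h => hv h.2,
      if_neg fun h => hv ((vanishesFrom_rank_iff hx).mp h.2).1, smul_zero]
  by_cases hA : dot A (u : GL (Idx X n) F) = A
  swap
  · rw [Finset.sum_eq_zero fun a _ => if_neg fun h =>
        hA ((dot_add_singleV_eq_self_iff h2 A hx a u.2 hv).mp h.1),
      if_neg fun h => hA h.1, smul_zero]
  have h : ∀ a : F, (if dot (A + singleV hx a) (u : GL (Idx X n) F) = A + singleV hx a ∧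
        VanishesFrom (rank x + 1) (u : GL (Idx X n) F)
      then (scalar θ (A + singleV hx a) (u : GL (Idx X n) F))⁻¹ • ρ (MulOpposite.op u) else 0) =
      θ (a * (((u : GL (Idx X n) F)⁻¹ : GL (Idx X n) F) : Mat X n F) x.1 x.2) •
        (scalar θ A (u : GL (Idx X n) F))⁻¹ • ρ (MulOpposite.op u) := by
    intro a
    rw [if_pos ⟨(dot_add_singleV_eq_self_iff h2 A hx a u.2 hv).mpr hA, hv⟩, scalar_add_singleV,
      mul_inv, AddChar.map_neg_eq_inv, inv_inv, mul_comm, smul_smul]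
  rw [Finset.sum_congr rfl fun a _ => h a, ← Finset.sum_smul,
    AddChar.sum_mulShift _ (AddChar.IsPrimitive.of_ne_one hθ)]
  by_cases h0 : (((u : GL (Idx X n) F)⁻¹ : GL (Idx X n) F) : Mat X n F) x.1 x.2 = 0
  · rw [if_pos h0, if_pos ⟨hA, (vanishesFrom_rank_iff hx).mpr ⟨hv, h0⟩⟩]
  · rw [if_neg h0, if_neg fun h => h0 ((vanishesFrom_rank_iff hx).mp h.2).2]
    simp

lemma stabSum_apply_of_dot_eq_self (θ : AddChar F ℂ) (ρ : Representation ℂ (sylowU X n F)ᵐᵒᵖ W)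
    (A : V X n F) {m : ℕ} (hm : matSize X n * matSize X n ≤ m) (t : sylowU X n F)
    (ht : dot A (t : GL (Idx X n) F) = A) (w : W) :
    stabSum θ ρ A m (ρ (MulOpposite.op t) w) =
      scalar θ A (t : GL (Idx X n) F) • stabSum θ ρ A m w := by
  classical
  have hv : ∀ u : GL (Idx X n) F, VanishesFrom m u := fun u y _ hy =>
    absurd (rank_lt y) (hm.trans hy).not_gt
  unfold stabSum
  rw [LinearMap.sum_apply, LinearMap.sum_apply, Finset.smul_sum]
  -- In a right module, acting by `t` and then by `s` is acting by `t * s`.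
  refine Fintype.sum_equiv (Equiv.mulLeft t) _ _ fun s => ?_
  have hs : dot A ((t * s : sylowU X n F) : GL (Idx X n) F) = dot A (s : GL (Idx X n) F) := by
    rw [Subgroup.coe_mul, dot_mul A t.2.2 s.2.2, ht]
  have hsc : scalar θ A ((t * s : sylowU X n F) : GL (Idx X n) F) =
      scalar θ A (t : GL (Idx X n) F) * scalar θ A (s : GL (Idx X n) F) := by
    rw [Subgroup.coe_mul, scalar_mul θ A t.2.2 s.2.2, ht]
  rw [Equiv.coe_mulLeft, hs]
  by_cases hA : dot A (s : GL (Idx X n) F) = A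
  · rw [if_pos ⟨hA, hv _⟩, if_pos ⟨hA, hv _⟩, hsc, LinearMap.smul_apply, LinearMap.smul_apply,
      smul_smul, mul_inv, mul_inv_cancel_left₀ (scalar_ne_zero θ A _), MulOpposite.op_mul, map_mul]
    rfl
  · rw [if_neg fun h => hA h.1, if_neg fun h => hA h.1]
    simp

end StabSum

/-! ### Construction of a main separated label. -/

section Separation

lemma mem_mainConditions_add_singleV {A : V X n F} {x : Idx X n × Idx X n} (hx : x ∈ pos X n)
    (hA : ∀ y ∈ pos X n, rank x ≤ rank y → (A : Mat X n F) y.1 y.2 = 0) {a : F}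
    {y : Idx X n × Idx X n} (hy : y ∈ mainConditions (A + singleV hx a)) :
    y ∈ mainConditions A ∨ y = x := by
  obtain ⟨hp, hne, hmax⟩ := hy
  by_cases hyx : y = x
  · exact Or.inr hyx
  refine Or.inl ⟨hp, ?_, ?_⟩
  · intro h
    apply hne
    rw [Submodule.coe_add, Matrix.add_apply, h, zero_add]
    refine Matrix.single_apply_of_ne _ _ _ _ _ ?_
    rintro ⟨h1, h3⟩
    exact hyx (Prod.ext h1.symm h3.symm)
  · intro k hk
    by_cases hxk : (y.1, k) = x
    · subst hxk
      exact hA _ hx le_rfl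
    · have := hmax k hk
      rw [Submodule.coe_add, Matrix.add_apply] at this
      have h0 : (singleV hx a : Mat X n F) y.1 k = 0 := by
        refine Matrix.single_apply_of_ne _ _ _ _ _ ?_
        rintro ⟨h1, h3⟩
        exact hxk (Prod.ext h1.symm h3.symm)
      rwa [h0, add_zero] at this

lemma isMainSeparated_of_not_isBlocked {A : V X n F}
    (h : ∀ x ∈ mainConditions A, ¬ IsBlocked A x) : IsMainSeparated A := by
  refine Set.eq_empty_iff_forall_notMem.mpr ?_
  rintro x ⟨hlimb, hx⟩
  apply h x hx
  rcases hlimb with ⟨y, hy, hxy | hxy⟩ | ⟨_, hanti, y, hy, rfl⟩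
  · obtain ⟨htri, hrow⟩ := hxy
    have hyrev : y.2 = x.1.rev := by rw [hrow, Fin.rev_rev]
    rcases hy.1 with hpos | ⟨_, hpos⟩
    · exact ⟨y, hy, by rw [hrow]; simpa using Fin.rev_lt_rev.mpr hpos.2, Or.inr hyrev⟩
    -- The arm of an anti-diagonal main condition lies in its own row, where it is already the
    -- rightmost non-zero entry, so no second main condition fits there.
    · exfalso
      have h1 : x.1 = y.1 := by rw [hrow, hpos.2, Fin.rev_rev]
      have h3 : x.2 < y.2 := by rw [hyrev]; exact htri.2
      exact hy.2.1 (by rw [← h1]; exact hx.2.2 _ h3)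
  · exact ⟨y, hy, hxy.2.2, Or.inl hxy.2.1.symm⟩
  · exact ⟨y, hy.1.1, by simpa using Fin.rev_lt_rev.mpr hy.2.2, Or.inl rfl⟩

/-- For every nonzero module there is a label without blocked main conditions whose stabilizer has
an eigenvector for the linear character `scalar`. -/
lemma exists_stabSum_ne_zero [Fintype F] [Fintype (sylowU X n F)] [Nontrivial W] (h2 : (2 : F) ≠ 0)
    {θ : AddChar F ℂ} (hθ : θ ≠ 1) (ρ : Representation ℂ (sylowU X n F)ᵐᵒᵖ W) (m : ℕ) :
    ∃ A : V X n F, (∀ y ∈ pos X n, m ≤ rank y → (A : Mat X n F) y.1 y.2 = 0) ∧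
      (∀ x ∈ mainConditions A, ¬ IsBlocked A x) ∧ stabSum θ ρ A m ≠ 0 := by
  induction m with
  | zero =>
    refine ⟨0, fun _ _ _ => rfl, fun x hx => absurd rfl hx.2.1, ?_⟩
    rw [stabSum_zero_zero h2]
    exact one_ne_zero
  | succ m ih =>
    obtain ⟨A, hA, hsep, hne⟩ := ih
    have hA' : ∀ y ∈ pos X n, m + 1 ≤ rank y → (A : Mat X n F) y.1 y.2 = 0 :=
      fun y hy hm => hA y hy (by omega)
    by_cases hex : ∃ x ∈ pos X n, rank x = m
    swap
    · refine ⟨A, hA', hsep, ?_⟩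
      rwa [← stabSum_congr θ ρ A (m := m)]
      intro u _ _
      rw [vanishesFrom_succ_iff]
      exact and_iff_left fun x hx hm => absurd ⟨x, hx, hm⟩ hex
    obtain ⟨x, hx, rfl⟩ := hex
    by_cases hb : IsBlocked A x
    · refine ⟨A, hA', hsep, ?_⟩
      rwa [← stabSum_congr θ ρ A (m := rank x)]
      intro u hu hAu
      rw [vanishesFrom_rank_iff hx]
      exact and_iff_left_of_imp fun h => hb.apply_eq_zero h2 hx hu hAu h
    have hsum := sum_stabSum_add_singleV h2 hθ ρ A hx
    obtain ⟨a, -, ha⟩ : ∃ a ∈ Finset.univ, stabSum θ ρ (A + singleV hx a) (rank x + 1) ≠ 0 := by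
      apply Finset.exists_ne_zero_of_sum_ne_zero
      rw [hsum]
      exact smul_ne_zero (Nat.cast_ne_zero.mpr Fintype.card_ne_zero) hne
    refine ⟨A + singleV hx a, ?_, ?_, ha⟩
    · intro y hy hm
      rw [Submodule.coe_add, Matrix.add_apply, hA' y hy hm, zero_add]
      refine Matrix.single_apply_of_ne _ _ _ _ _ ?_
      rintro ⟨h1, h3⟩
      obtain rfl : x = y := Prod.ext h1 h3
      omega
    · rintro z hz ⟨y, hy, hlt, hcol⟩
      rcases mem_mainConditions_add_singleV hx hA hy with hy' | rfl
      · rcases mem_mainConditions_add_singleV hx hA hz with hz' | rfl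
        · exact hsep z hz' ⟨y, hy', hlt, hcol⟩
        · exact hb ⟨y, hy', hlt, hcol⟩
      -- The newly filled position cannot block anything, because `A` is still zero in all lower
      -- rows.
      · rcases mem_mainConditions_add_singleV hx hA hz with hz | rfl
        · exact hz.2.1 (hA z hz.1 (rank_lt_of_row_lt hlt).le)
        · exact lt_irrefl _ hlt

end Separation

/-! ### Frobenius reciprocity for orbit modules. -/

section OrbitMap

variable [Fintype (sylowU X n F)] (θ : AddChar F ℂ) (A : V X n F)
  (ρ : Representation ℂ (sylowU X n F)ᵐᵒᵖ W) (f : W →ₗ[ℂ] ℂ)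

/-- The map `w ↦ ∑ u, f (w u⁻¹) [A] u` to the orbit module of `[A]`. -/
def orbitMap : ρ.IntertwiningMap (orbitModule θ A).toRepresentation where
  toLinearMap := LinearMap.codRestrict _
    (∑ u : sylowU X n F, (f ∘ₗ ρ (MulOpposite.op u⁻¹)).smulRight
      (monomialRep X n θ (MulOpposite.op u) (Finsupp.single A 1))) fun w => by
    rw [LinearMap.sum_apply]
    refine Submodule.sum_mem _ fun u _ => Submodule.smul_mem _ _
      ((orbitModule θ A).apply_mem_toSubmodule _ (Submodule.subset_span ⟨A, ?_, rfl⟩))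
    exact ⟨1, one_mem _, (dot_one A).symm⟩
  isIntertwining' v := by
    refine LinearMap.ext fun w => Subtype.ext ?_
    change (∑ u : sylowU X n F, (f ∘ₗ ρ (MulOpposite.op u⁻¹)).smulRight
        (monomialRep X n θ (MulOpposite.op u) (Finsupp.single A 1))) (ρ v w) =
      monomialRep X n θ v ((∑ u : sylowU X n F, (f ∘ₗ ρ (MulOpposite.op u⁻¹)).smulRight
        (monomialRep X n θ (MulOpposite.op u) (Finsupp.single A 1))) w)
    rw [LinearMap.sum_apply, LinearMap.sum_apply, map_sum]
    refine (Fintype.sum_equiv (Equiv.mulRight v.unop) _ _ fun u => ?_).symm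
    have h1 : ρ (MulOpposite.op (u * v.unop)⁻¹) (ρ v w) = ρ (MulOpposite.op u⁻¹) w := by
      rw [← Module.End.mul_apply, ← map_mul]
      congr 2
      apply MulOpposite.unop_injective
      simp
    have h3 : monomialRep X n θ (MulOpposite.op (u * v.unop)) (Finsupp.single A 1) =
        monomialRep X n θ v (monomialRep X n θ (MulOpposite.op u) (Finsupp.single A 1)) := by
      rw [← Module.End.mul_apply, ← map_mul]
      rfl
    rw [Equiv.coe_mulRight, LinearMap.smulRight_apply, LinearMap.smulRight_apply,
      LinearMap.comp_apply, LinearMap.comp_apply, h1, h3, map_smul]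

variable {θ A ρ f}

lemma orbitMap_apply (w : W) : (orbitMap θ A ρ f w : CharSpace X n F) =
    ∑ u : sylowU X n F, f (ρ (MulOpposite.op u⁻¹) w) •
      scalar θ A (u : GL (Idx X n) F) • Finsupp.single (dot A (u : GL (Idx X n) F)) (1 : ℂ) := by
  change (∑ u : sylowU X n F, (f ∘ₗ ρ (MulOpposite.op u⁻¹)).smulRight
        (monomialRep X n θ (MulOpposite.op u) (Finsupp.single A 1))) w = _
  rw [LinearMap.sum_apply]
  refine Finset.sum_congr rfl fun u _ => ?_
  rw [LinearMap.smulRight_apply, ← monomialMap_single]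
  rfl

/-- The coefficient of `[A]` in the image of `w` is `f w` times the order of the stabilizer: each
stabilizing `u` contributes `f w`, as the eigenvalue of `u⁻¹` cancels the scalar of `u`. -/
lemma orbitMap_ne_zero (hf : f ≠ 0)
    (heig : ∀ t : sylowU X n F, dot A (t : GL (Idx X n) F) = A → ∀ w,
      f (ρ (MulOpposite.op t) w) = scalar θ A (t : GL (Idx X n) F) * f w) :
    orbitMap θ A ρ f ≠ 0 := by
  classical
  intro h0
  apply hf
  refine LinearMap.ext fun w => ?_
  have h : (orbitMap θ A ρ f w : CharSpace X n F) A = 0 := by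
    rw [h0]; rfl
  rw [orbitMap_apply, Finsupp.finsetSum_apply] at h
  have hterm : ∀ u : sylowU X n F, (f (ρ (MulOpposite.op u⁻¹) w) •
      scalar θ A (u : GL (Idx X n) F) •
        Finsupp.single (dot A (u : GL (Idx X n) F)) (1 : ℂ) : CharSpace X n F) A =
      if dot A (u : GL (Idx X n) F) = A then f w else 0 := by
    intro u
    rw [Finsupp.smul_apply, Finsupp.smul_apply, Finsupp.single_apply]
    split_ifs with hu
    · have hu' : dot A ((u⁻¹ : sylowU X n F) : GL (Idx X n) F) = A := by
        conv_lhs => rw [← hu]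
        rw [← dot_mul A u.2.2 (u⁻¹).2.2, Subgroup.coe_inv, mul_inv_cancel, dot_one]
      have hsc : scalar θ A ((u⁻¹ : sylowU X n F) : GL (Idx X n) F) *
          scalar θ A (u : GL (Idx X n) F) = 1 := by
        have := scalar_mul θ A (u⁻¹).2.2 u.2.2
        rw [hu', Subgroup.coe_inv, inv_mul_cancel, scalar_one] at this
        exact this.symm
      rw [heig _ hu', smul_eq_mul, smul_eq_mul, mul_one]
      linear_combination f w * hsc
    · simp
  rw [Finset.sum_congr rfl fun u _ => hterm u, ← Finset.sum_filter, Finset.sum_const,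
    nsmul_eq_mul] at h
  refine (mul_eq_zero.mp h).resolve_left (Nat.cast_ne_zero.mpr (Finset.card_ne_zero_of_mem
    (Finset.mem_filter.mpr ⟨Finset.mem_univ (1 : sylowU X n F), dot_one A⟩)))

end OrbitMap

lemma isConstituent_of_ne_zero {G W₁ W₂ : Type*} [Monoid G] [AddCommGroup W₁] [Module ℂ W₁]
    [AddCommMonoid W₂] [Module ℂ W₂] {ρ : Representation ℂ G W₁} {σ : Representation ℂ G W₂}
    (hρ : ρ.IsIrreducible) (f : ρ.IntertwiningMap σ) (hf : f ≠ 0) : IsConstituent ρ σ := by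
  have hinj : Function.Injective f.toLinearMap := by
    rcases hρ.eq_bot_or_eq_top f.ker with hker | hker
    · intro x y hxy
      have hmem : x - y ∈ f.ker := by
        rw [Representation.IntertwiningMap.mem_ker]
        change f.toLinearMap (x - y) = 0
        rw [sub_eq_add_neg, map_add, hxy, ← map_add, add_neg_cancel, map_zero]
      rw [hker] at hmem
      exact sub_eq_zero.mp hmem
    · refine absurd (Representation.IntertwiningMap.ext (LinearMap.ext fun w => ?_)) hf
      have hmem : w ∈ f.ker := by
        rw [hker]
        exact Submodule.mem_top
      rwa [Representation.IntertwiningMap.mem_ker] at hmem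
  exact ⟨f.range, ⟨Representation.Equiv.mk (LinearEquiv.ofInjective f.toLinearMap hinj) fun g =>
    LinearMap.ext fun w =>
      Subtype.ext (Representation.IntertwiningMap.isIntertwining _ _ f g w)⟩⟩

end

end SylowClassical

theorem theorem3 (X : SylowClassical.DynkinType) (n : ℕ) (p : ℕ) [Fact p.Prime] (hp : p ≠ 2)
    (F : Type*) [Field F] [Fintype F] [CharP F p]
    (θ : AddChar F ℂ) (hθ : θ ≠ 1)
    (W : Type*) [AddCommGroup W] [Module ℂ W]
    (ρ : Representation ℂ (SylowClassical.sylowU X n F)ᵐᵒᵖ W) (hρ : ρ.IsIrreducible) :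
    ∃ A : SylowClassical.V X n F, SylowClassical.IsMainSeparated A ∧
      SylowClassical.IsConstituent ρ (SylowClassical.orbitModule θ A).toRepresentation := by
  classical
  have h2 : (2 : F) ≠ 0 := by
    intro h
    have h' : ((2 : ℕ) : F) = 0 := by exact_mod_cast h
    rw [CharP.cast_eq_zero_iff F p] at h'
    exact hp ((Nat.prime_dvd_prime_iff_eq Fact.out Nat.prime_two).mp h')
  have : Fintype (SylowClassical.sylowU X n F) := Fintype.ofFinite _
  have : Nontrivial W := by
    by_contra hW
    rw [not_nontrivial_iff_subsingleton] at hW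
    obtain ⟨S, T, hST⟩ := hρ.exists_pair_ne
    exact hST (SetLike.ext fun w => by
      rw [Subsingleton.elim w 0]
      exact iff_of_true S.toSubmodule.zero_mem T.toSubmodule.zero_mem)
  -- Every rank is below `N * N`, so at this bound the vanishing condition is vacuous and the sum
  -- runs over the whole stabilizer.
  obtain ⟨A, -, hsep, hne⟩ := SylowClassical.exists_stabSum_ne_zero h2 hθ ρ
    (SylowClassical.matSize X n * SylowClassical.matSize X n)
  refine ⟨A, SylowClassical.isMainSeparated_of_not_isBlocked hsep, ?_⟩
  obtain ⟨w, hw⟩ := DFunLike.ne_iff.mp hne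
  obtain ⟨φ, hφ⟩ := Module.Projective.exists_dual_ne_zero ℂ hw
  have hmap : SylowClassical.orbitMap θ A ρ (φ ∘ₗ SylowClassical.stabSum θ ρ A
      (SylowClassical.matSize X n * SylowClassical.matSize X n)) ≠ 0 := by
    refine SylowClassical.orbitMap_ne_zero (fun h => hφ (LinearMap.congr_fun h w)) fun t ht w => ?_
    rw [LinearMap.comp_apply, SylowClassical.stabSum_apply_of_dot_eq_self θ ρ A le_rfl t ht,
      map_smul, smul_eq_mul]
    rfl
  exact SylowClassical.isConstituent_of_ne_zero hρ _ hmap
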